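/- A distribution $\varphi$ on $\{-1,1\}^n$ is called $k$-wise uniform if its marginal on every set of at most $k$ coordinates is uniform (for real $r\ge 0$, $r$-wise uniform means $\lfloor r\rfloor$-wise uniform), and $\delta$-far from $k$-wise uniform if its total variation distance to every $k$-wise uniform distribution is more than $\delta$. A tester with $m$ samples is a function of $m$ independent samples from an unknown $\varphi$ with values in $\{\text{Yes},\text{No}\}$; it distinguishes a property $Y$ from a property $N$ if it answers Yes with probability at least $2/3$ whenever $\varphi$ has $Y$, and No with probability at least $2/3$ whenever $\varphi$ has $N$. There is an absolute constant $C>0$ such that the following hold for all integers $n,k\ge 1$ and all $0<\delta\le 1$. (1) There is a tester that distinguishes the fully uniform distribution from the distributions that are $\delta$-far from $k$-wise uniform, with a number of samples at most $$(Ck)^k\, n^{k/2}\,\frac{1}{\delta^{2}}\left(\log\frac n\delta\right)^{k/2}.$$ (2) For every real $\alpha>4$ there is a tester that distinguishes the $\alpha k$-wise uniform distributions from the distributions that are $\delta$-far from $k$-wise uniform, with a number of samples at most $$(C\alpha)^{k/2}\, n^{k/2}\,\frac{1}{\delta^{2}}\left(\frac{n^k}{\delta^4}\right)^{1/(\alpha-2)}.$$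 -/

import Mathlib

namespace KWise

/-- The Hamming cube `{-1, 1}ⁿ`; the group `ℤˣ` of integer units is `{-1, 1}`. -/
abbrev Cube (n : ℕ) : Type := Fin n → ℤˣ

/-- A probability distribution on `{-1, 1}ⁿ`, given by its density with respect to the uniform
distribution: a nonnegative function whose average over the cube is `1`. -/
structure Density (n : ℕ) where
  toFun : Cube n → ℝ
  nonneg : ∀ x, 0 ≤ toFun x
  mean_eq_one : (∑ x, toFun x) / 2 ^ n = 1

namespace Density

variable {n : ℕ}

/-- The probability `φ(x) / 2ⁿ` of the single outcome `x`. -/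
noncomputable def mass (φ : Density n) (x : Cube n) : ℝ := φ.toFun x / 2 ^ n

open Classical in
/-- The probability that `x ∼ φ` lies in `A`. -/
noncomputable def prob (φ : Density n) (A : Set (Cube n)) : ℝ :=
  ∑ x, if x ∈ A then φ.mass x else 0

open Classical in
/-- The probability that `m` independent samples from `φ` satisfy the event `A`. -/
noncomputable def sampleProb (φ : Density n) (m : ℕ) (A : Set (Fin m → Cube n)) : ℝ :=
  ∑ X, if X ∈ A then ∏ i, φ.mass (X i) else 0

/-- The fully uniform distribution has constant density `1`. -/
def IsUniform (φ : Density n) : Prop := ∀ x, φ.toFun x = 1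

/-- `φ` is `k`-wise uniform: its marginal distribution on every set `S` of at most `k`
coordinates is uniform on `{-1, 1}^S`. For `k ≤ n` it is the same to ask this for the sets of
exactly `k` coordinates; for `k ≥ n` the condition says that `φ` is fully uniform. -/
def IsKWiseUniform (k : ℕ) (φ : Density n) : Prop :=
  ∀ S : Finset (Fin n), S.card ≤ k → ∀ a : Cube n,
    φ.prob {x | ∀ i ∈ S, x i = a i} = 1 / 2 ^ S.card

/-- Total variation distance, `½ E|φ - ψ|` with `E` the average over the cube. -/
noncomputable def dTV (φ ψ : Density n) : ℝ :=
  1 / 2 * ((∑ x, |φ.toFun x - ψ.toFun x|) / 2 ^ n)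

/-- `φ` is `δ`-far from `k`-wise uniform: its total variation distance to every `k`-wise uniform
distribution is more than `δ`. -/
def IsFarFromKWise (k : ℕ) (δ : ℝ) (φ : Density n) : Prop :=
  ∀ ψ : Density n, ψ.IsKWiseUniform k → δ < dTV φ ψ

end Density

/-- A tester that sees `m` samples from `{-1, 1}ⁿ` and answers "Yes" (`true`) or "No" (`false`). -/
abbrev Tester (n m : ℕ) : Type := (Fin m → Cube n) → Bool

/-- The tester `T`, given `m` independent samples from an unknown `φ`, answers "Yes" with
probability at least `2/3` whenever `φ` has the property `Y`, and "No" with probability at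
least `2/3` whenever `φ` has the property `N`. -/
def Tester.Distinguishes {n m : ℕ} (T : Tester n m) (Y N : Density n → Prop) : Prop :=
  (∀ φ, Y φ → 2 / 3 ≤ φ.sampleProb m {X | T X = true}) ∧
  (∀ φ, N φ → 2 / 3 ≤ φ.sampleProb m {X | T X = false})

end KWise

namespace KWise

open Finset

variable {n : ℕ}

/-! Both claims follow from one tester separating `2k`-wise uniform from `δ`-far, with about `9 ^ k
* √L / δ ^ 2` samples, where `L ≤ n ^ k` is the number of parities of degree `1, …, k`.

Being far forces Fourier weight: `Density.IsFarFromKWise.lt_weight` gives weight above `δ ^ 2 / 9 ^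
k` in these degrees. Otherwise the negated coefficients, divided by `δ`, are those of a
distribution, and mixing it in cancels them. If that distribution did not exist, Hahn–Banach would
yield a positive polynomial of degree at most `k` whose second moment is too large for its mean,
against hypercontractivity.

The weight is estimated by the inner product of the empirical parity sums of two independent
half-samples. Its variance is governed by `B`, the sum of squared parity covariances, which equals
`L` under `2k`-wise uniformity but may be large for a far distribution. Since `B` is the squared
norm of the mean of the pairwise products of parities, the same statistic estimates it. The tester
in `exists_tester` rejects if either estimate is large: `B > 4L` is caught by the second, and
otherwise the first is accurate. -/

/-! ### Fourier analysis on the cube -/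

/-- The parity function `χ_S(x) = ∏_{i ∈ S} x_i`. -/
noncomputable def chi (S : Finset (Fin n)) (x : Cube n) : ℝ := ∏ i ∈ S, ((x i : ℤ) : ℝ)

/-- The average of a function over the cube. -/
noncomputable def mean (f : Cube n → ℝ) : ℝ := (∑ x, f x) / 2 ^ n

/-- The nonempty sets of at most `k` coordinates. -/
def low (n k : ℕ) : Finset (Finset (Fin n)) := univ.filter fun S => S.Nonempty ∧ S.card ≤ k

theorem mem_low {k : ℕ} {S : Finset (Fin n)} : S ∈ low n k ↔ S.Nonempty ∧ S.card ≤ k := by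
  simp [low]

theorem unit_cast_sq (u : ℤˣ) : ((u : ℤ) : ℝ) * ((u : ℤ) : ℝ) = 1 := by
  rcases Int.units_eq_one_or u with rfl | rfl <;> norm_num

theorem chi_empty (x : Cube n) : chi ∅ x = 1 := by simp [chi]

theorem chi_mul_self (S : Finset (Fin n)) (x : Cube n) : chi S x * chi S x = 1 := by
  simp only [chi, ← prod_mul_distrib, unit_cast_sq, prod_const_one]

theorem abs_chi (S : Finset (Fin n)) (x : Cube n) : |chi S x| = 1 := by
  have h := chi_mul_self S x
  rw [← abs_mul_abs_self] at h
  nlinarith [abs_nonneg (chi S x)]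

theorem chi_eq_prod_univ (S : Finset (Fin n)) (x : Cube n) :
    chi S x = ∏ i, if i ∈ S then ((x i : ℤ) : ℝ) else 1 := by
  simp [chi, Finset.prod_ite_mem]

theorem chi_mul_chi (S T : Finset (Fin n)) (x : Cube n) :
    chi S x * chi T x = chi (symmDiff S T) x := by
  rw [chi_eq_prod_univ, chi_eq_prod_univ, chi_eq_prod_univ, ← prod_mul_distrib]
  refine prod_congr rfl fun i _ => ?_
  by_cases h1 : i ∈ S <;> by_cases h2 : i ∈ T <;> simp [mem_symmDiff, h1, h2, unit_cast_sq]

theorem chi_mul_arg (S : Finset (Fin n)) (x y : Cube n) :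
    chi S (x * y) = chi S x * chi S y := by
  simp [chi, prod_mul_distrib]

theorem chi_insert {a : Fin n} {S : Finset (Fin n)} (h : a ∉ S) (x : Cube n) :
    chi (insert a S) x = ((x a : ℤ) : ℝ) * chi S x := by
  simp [chi, prod_insert h]

theorem chi_mulSingle (S : Finset (Fin n)) (a : Fin n) :
    chi S (Pi.mulSingle a (-1)) = if a ∈ S then -1 else 1 := by
  unfold chi
  split_ifs with h
  · rw [prod_eq_single_of_mem a h]
    · simp
    · intro b _ hb
      simp [Pi.mulSingle_eq_of_ne hb]
  · refine prod_eq_one fun b hb => ?_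
    have : b ≠ a := fun e => h (e ▸ hb)
    simp [Pi.mulSingle_eq_of_ne this]

/-- Flipping coordinate `a` permutes the cube. This gives both the orthogonality of parities and the
cancellation of odd terms in Bonami's lemma. -/
theorem sum_eq_zero_of_antisymm (a : Fin n) (f : Cube n → ℝ)
    (h : ∀ x, f (Pi.mulSingle a (-1) * x) = -f x) : ∑ x, f x = 0 := by
  have := Equiv.sum_comp (Equiv.mulLeft (Pi.mulSingle a (-1) : Cube n)) f
  simp only [Equiv.coe_mulLeft, h, sum_neg_distrib] at this
  linarith

theorem sum_chi {S : Finset (Fin n)} (h : S.Nonempty) : ∑ x, chi S x = 0 := by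
  obtain ⟨a, ha⟩ := h
  refine sum_eq_zero_of_antisymm a _ fun x => ?_
  rw [chi_mul_arg, chi_mulSingle, if_pos ha, neg_one_mul]

theorem mean_chi (S : Finset (Fin n)) : mean (chi S) = if S = ∅ then 1 else 0 := by
  unfold mean
  split_ifs with h
  · subst h
    simp [chi_empty]
  · rw [sum_chi (nonempty_iff_ne_empty.2 h), zero_div]

theorem mean_add (f g : Cube n → ℝ) : mean (fun x => f x + g x) = mean f + mean g := by
  simp [mean, sum_add_distrib, add_div]

theorem mean_const_mul (c : ℝ) (f : Cube n → ℝ) : mean (fun x => c * f x) = c * mean f := by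
  simp [mean, ← mul_sum, mul_div_assoc]

theorem mean_const (c : ℝ) : mean (fun _ : Cube n => c) = c := by
  simp [mean]

theorem mean_sum {ι : Type*} (s : Finset ι) (f : ι → Cube n → ℝ) :
    mean (fun x => ∑ i ∈ s, f i x) = ∑ i ∈ s, mean (f i) := by
  simp only [mean]
  rw [sum_comm, sum_div]

theorem mean_nonneg {f : Cube n → ℝ} (h : ∀ x, 0 ≤ f x) : 0 ≤ mean f :=
  div_nonneg (sum_nonneg fun x _ => h x) (by positivity)

theorem mean_pos {f : Cube n → ℝ} (h : ∀ x, 0 < f x) : 0 < mean f :=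
  div_pos (sum_pos (fun x _ => h x) univ_nonempty) (by positivity)

theorem mean_sq_le {f g r : Cube n → ℝ} (hf : ∀ x, 0 ≤ f x) (hg : ∀ x, 0 ≤ g x)
    (h : ∀ x, r x ^ 2 = f x * g x) : mean r ^ 2 ≤ mean f * mean g := by
  have := sum_sq_le_sum_mul_sum_of_sq_le_mul univ (fun x _ => hf x) (fun x _ => hg x)
    (fun x _ => (h x).le)
  unfold mean
  rw [div_pow, div_mul_div_comm, ← sq]
  gcongr

/-- Parseval's identity. -/
theorem mean_sq_sum_chi (A : Finset (Finset (Fin n))) (c : Finset (Fin n) → ℝ) :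
    mean (fun x => (∑ S ∈ A, c S * chi S x) ^ 2) = ∑ S ∈ A, c S ^ 2 := by
  have h : ∀ x : Cube n, (∑ S ∈ A, c S * chi S x) ^ 2
      = ∑ S ∈ A, ∑ T ∈ A, (c S * c T) * chi (symmDiff S T) x := by
    intro x
    rw [sq, sum_mul_sum]
    refine sum_congr rfl fun S _ => sum_congr rfl fun T _ => ?_
    rw [← chi_mul_chi]
    ring
  simp only [h]
  rw [mean_sum]
  refine sum_congr rfl fun S hS => ?_
  rw [mean_sum, sum_eq_single_of_mem S hS]
  · rw [mean_const_mul, mean_chi]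
    simp [sq]
  · intro T _ hT
    rw [mean_const_mul, mean_chi, if_neg, mul_zero]
    exact fun e => hT (symmDiff_eq_bot.1 e).symm

/-! ### Low-degree polynomials and hypercontractivity -/

/-- The polynomial on the cube with coefficients `c` and monomials of degree at most `k` in the
coordinates in `s`. -/
noncomputable def lowPoly (s : Finset (Fin n)) (k : ℕ) (c : Finset (Fin n) → ℝ) (x : Cube n) : ℝ :=
  ∑ S ∈ s.powerset with S.card ≤ k, c S * chi S x

theorem lowPoly_empty (k : ℕ) (c : Finset (Fin n) → ℝ) (x : Cube n) :
    lowPoly ∅ k c x = c ∅ := by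
  simp [lowPoly, Finset.filter_singleton, chi_empty]

theorem lowPoly_zero (s : Finset (Fin n)) (c : Finset (Fin n) → ℝ) (x : Cube n) :
    lowPoly s 0 c x = c ∅ := by
  have : (s.powerset.filter fun S => S.card ≤ 0) = {∅} := by
    ext S
    simp only [mem_filter, mem_powerset, mem_singleton, nonpos_iff_eq_zero, card_eq_zero]
    exact ⟨fun h => h.2, fun h => ⟨h ▸ empty_subset s, h⟩⟩
  rw [lowPoly, this, sum_singleton, chi_empty, mul_one]

theorem lowPoly_insert {a : Fin n} {s : Finset (Fin n)} (ha : a ∉ s) (k : ℕ)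
    (c : Finset (Fin n) → ℝ) (x : Cube n) :
    lowPoly (insert a s) (k + 1) c x
      = lowPoly s (k + 1) c x + ((x a : ℤ) : ℝ) * lowPoly s k (fun S => c (insert a S)) x := by
  simp only [lowPoly, sum_filter]
  rw [sum_powerset_insert ha]
  congr 1
  rw [mul_sum]
  refine sum_congr rfl fun S hS => ?_
  have haS : a ∉ S := fun h => ha (mem_powerset.1 hS h)
  rw [card_insert_of_notMem haS, chi_insert haS]
  simp only [Nat.add_le_add_iff_right]
  split_ifs <;> ring

theorem lowPoly_flip {a : Fin n} {s : Finset (Fin n)} (ha : a ∉ s) (k : ℕ)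
    (c : Finset (Fin n) → ℝ) (x : Cube n) :
    lowPoly s k c (Pi.mulSingle a (-1) * x) = lowPoly s k c x := by
  refine sum_congr rfl fun S hS => ?_
  have haS : a ∉ S := fun h => ha (mem_powerset.1 (mem_filter.1 hS).1 h)
  rw [chi_mul_arg, chi_mulSingle, if_neg haS, one_mul]

/-- Bonami's lemma: hypercontractivity of low-degree polynomials from `L²` to `L⁴`. -/
theorem mean_lowPoly_pow_four_le (s : Finset (Fin n)) : ∀ (k : ℕ) (c : Finset (Fin n) → ℝ),
    mean (fun x => lowPoly s k c x ^ 4) ≤ 9 ^ k * mean (fun x => lowPoly s k c x ^ 2) ^ 2 := by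
  have hconst : ∀ (k : ℕ) (b : ℝ), b ^ 4 ≤ 9 ^ k * (b ^ 2) ^ 2 := fun k b => by
    have : (1 : ℝ) ≤ 9 ^ k := one_le_pow₀ (by norm_num)
    nlinarith [sq_nonneg (b ^ 2)]
  induction s using Finset.induction_on with
  | empty =>
    intro k c
    simp only [lowPoly_empty, mean_const]
    exact hconst k _
  | insert a s ha ih =>
    intro k c
    cases k with
    | zero =>
      simp only [lowPoly_zero, mean_const]
      exact hconst 0 _
    | succ k =>
      set r := lowPoly s (k + 1) c
      set q := lowPoly s k fun S => c (insert a S)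
      -- With `r + x_a q` expanded, the terms odd in `x_a` average to zero because `r` and `q` do
      -- not involve `x_a`.
      have hodd : ∀ g : Cube n → ℝ, (∀ x, g (Pi.mulSingle a (-1) * x) = g x) →
          mean (fun x => ((x a : ℤ) : ℝ) * g x) = 0 := by
        intro g hg
        unfold mean
        rw [sum_eq_zero_of_antisymm a, zero_div]
        intro x
        rw [hg]
        simp
      have h4 : mean (fun x => lowPoly (insert a s) (k + 1) c x ^ 4)
          = mean (fun x => r x ^ 4) + 6 * mean (fun x => r x ^ 2 * q x ^ 2)
            + mean (fun x => q x ^ 4) := by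
        rw [← mean_const_mul, ← mean_add, ← mean_add,
          ← add_zero (mean fun x => r x ^ 4 + 6 * (r x ^ 2 * q x ^ 2) + q x ^ 4),
          ← hodd (fun x => 4 * r x ^ 3 * q x + 4 * r x * q x ^ 3), ← mean_add]
        · congr 1
          ext x
          rw [lowPoly_insert ha]
          have hx := unit_cast_sq (x a)
          change (r x + ((x a : ℤ) : ℝ) * q x) ^ 4 = _
          linear_combination (6 * r x ^ 2 * q x ^ 2 + 4 * r x * q x ^ 3 * ((x a : ℤ) : ℝ)
            + q x ^ 4 * (((x a : ℤ) : ℝ) * ((x a : ℤ) : ℝ) + 1)) * hx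
        · intro x
          simp only [r, q, lowPoly_flip ha]
      have h2 : mean (fun x => lowPoly (insert a s) (k + 1) c x ^ 2)
          = mean (fun x => r x ^ 2) + mean (fun x => q x ^ 2) := by
        rw [← mean_add, ← add_zero (mean fun x => r x ^ 2 + q x ^ 2),
          ← hodd (fun x => 2 * r x * q x), ← mean_add]
        · congr 1
          ext x
          rw [lowPoly_insert ha]
          have hx := unit_cast_sq (x a)
          change (r x + ((x a : ℤ) : ℝ) * q x) ^ 2 = _
          linear_combination (q x ^ 2) * hx
        · intro x
          simp only [r, q, lowPoly_flip ha]
      have hr := ih (k + 1) c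
      have hq := ih k fun S => c (insert a S)
      change mean (fun x => r x ^ 4) ≤ 9 ^ (k + 1) * mean (fun x => r x ^ 2) ^ 2 at hr
      change mean (fun x => q x ^ 4) ≤ 9 ^ k * mean (fun x => q x ^ 2) ^ 2 at hq
      have hrq : mean (fun x => r x ^ 2 * q x ^ 2) ^ 2
          ≤ mean (fun x => r x ^ 4) * mean (fun x => q x ^ 4) :=
        mean_sq_le (fun x => by positivity) (fun x => by positivity) fun x => by ring
      rw [h4, h2]
      set R := mean fun x => r x ^ 2
      set Q := mean fun x => q x ^ 2
      have hR : 0 ≤ R := mean_nonneg fun x => by positivity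
      have hQ : 0 ≤ Q := mean_nonneg fun x => by positivity
      have hq0 : 0 ≤ mean fun x => q x ^ 4 := mean_nonneg fun x => by positivity
      -- The degrees `k + 1` and `k` give the geometric mean `3 * 9 ^ k`. Then `6 * 3 = 2 * 9`
      -- matches the cross term of `9 * (R + Q) ^ 2`, which is why the base is `9`.
      have hmix : mean (fun x => r x ^ 2 * q x ^ 2) ≤ 3 * 9 ^ k * (R * Q) := by
        refine le_of_sq_le_sq ?_ (by positivity)
        calc _ ≤ _ := hrq
          _ ≤ (9 ^ (k + 1) * R ^ 2) * (9 ^ k * Q ^ 2) := by gcongr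
          _ = _ := by ring
      have h9 : (0 : ℝ) < 9 ^ k := by positivity
      calc _ ≤ 9 ^ (k + 1) * R ^ 2 + 6 * (3 * 9 ^ k * (R * Q)) + 9 ^ k * Q ^ 2 := by gcongr
        _ ≤ 9 ^ (k + 1) * (R + Q) ^ 2 := by
          rw [pow_succ]
          nlinarith [mul_nonneg h9.le (sq_nonneg Q)]

/-- A nonnegative low-degree polynomial has second moment bounded in terms of its mean. -/
theorem mean_sq_le_of_lowPoly_pos (s : Finset (Fin n)) (k : ℕ) (c : Finset (Fin n) → ℝ)
    (h : ∀ x, 0 < lowPoly s k c x) :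
    mean (fun x => lowPoly s k c x ^ 2) ≤ 9 ^ k * mean (lowPoly s k c) ^ 2 := by
  set p := lowPoly s k c
  have h4 := mean_lowPoly_pow_four_le s k c
  change mean (fun x => p x ^ 4) ≤ 9 ^ k * mean (fun x => p x ^ 2) ^ 2 at h4
  have h12 : mean (fun x => p x ^ 2) ^ 2 ≤ mean p * mean fun x => p x ^ 3 :=
    mean_sq_le (fun x => (h x).le) (fun x => pow_nonneg (h x).le 3) fun x => by ring
  have h34 : mean (fun x => p x ^ 3) ^ 2 ≤ mean (fun x => p x ^ 2) * mean fun x => p x ^ 4 :=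
    mean_sq_le (fun x => pow_nonneg (h x).le 2) (fun x => pow_nonneg (h x).le 4) fun x => by ring
  have hA : 0 < mean fun x => p x ^ 2 := mean_pos fun x => pow_pos (h x) 2
  have hM : 0 < mean p := mean_pos h
  set A := mean fun x => p x ^ 2
  -- Two Cauchy–Schwarz steps interpolate the second moment between the first and the fourth; the
  -- fourth is at most `9 ^ k * A ^ 2`.
  have key : A ^ 3 * A ≤ A ^ 3 * (9 ^ k * mean p ^ 2) := by
    calc A ^ 3 * A = (A ^ 2) ^ 2 := by ring
      _ ≤ (mean p * mean fun x => p x ^ 3) ^ 2 := by gcongr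
      _ = mean p ^ 2 * (mean fun x => p x ^ 3) ^ 2 := by ring
      _ ≤ mean p ^ 2 * (A * (9 ^ k * A ^ 2)) := by
        gcongr
        exact h34.trans (by gcongr)
      _ = _ := by ring
  exact le_of_mul_le_mul_left key (by positivity)

/-! ### Fourier coefficients and `k`-wise uniformity -/

/-- The expectation `E_{x ∼ φ} f(x)`. -/
noncomputable def Density.expect (φ : Density n) (f : Cube n → ℝ) : ℝ := ∑ x, φ.mass x * f x

theorem Density.mass_nonneg (φ : Density n) (x : Cube n) : 0 ≤ φ.mass x :=
  div_nonneg (φ.nonneg x) (by positivity)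

theorem Density.sum_mass (φ : Density n) : ∑ x, φ.mass x = 1 := by
  simp only [Density.mass, ← sum_div, φ.mean_eq_one]

open Classical in
theorem indicator_agree (S : Finset (Fin n)) (a x : Cube n) :
    (if ∀ i ∈ S, x i = a i then (1 : ℝ) else 0)
      = 1 / 2 ^ S.card * ∑ T ∈ S.powerset, chi T a * chi T x := by
  have h1 : ∀ i, (if x i = a i then (1 : ℝ) else 0)
      = 1 / 2 * (((a i : ℤ) : ℝ) * ((x i : ℤ) : ℝ) + 1) := by
    intro i
    rcases Int.units_eq_one_or (x i) with h | h <;> rcases Int.units_eq_one_or (a i) with h' | h'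
      <;> rw [h, h'] <;> norm_num
  have h2 : (if ∀ i ∈ S, x i = a i then (1 : ℝ) else 0)
      = ∏ i ∈ S, if x i = a i then (1 : ℝ) else 0 := by
    rw [prod_ite_zero]
    simp
  rw [h2]
  simp only [h1, prod_mul_distrib, prod_const, prod_add]
  simp [chi]

theorem Density.isKWiseUniform_of_expect_chi (φ : Density n) (k : ℕ)
    (h : ∀ S ∈ low n k, φ.expect (chi S) = 0) : φ.IsKWiseUniform k := by
  classical
  intro S hS a
  have h1 : φ.prob {x | ∀ i ∈ S, x i = a i}
      = ∑ x, φ.mass x * (1 / 2 ^ S.card * ∑ T ∈ S.powerset, chi T a * chi T x) := by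
    unfold Density.prob
    refine sum_congr rfl fun x _ => ?_
    rw [← indicator_agree]
    simp only [Set.mem_ofPred_eq, mul_ite, mul_one, mul_zero]
    congr
  have h2 : ∀ x, φ.mass x * (1 / 2 ^ S.card * ∑ T ∈ S.powerset, chi T a * chi T x)
      = ∑ T ∈ S.powerset, 1 / 2 ^ S.card * chi T a * (φ.mass x * chi T x) := by
    intro x
    rw [mul_sum, mul_sum]
    exact sum_congr rfl fun T _ => by ring
  rw [h1]
  simp only [h2]
  rw [sum_comm, sum_eq_single_of_mem ∅ (empty_mem_powerset S)]
  · simp [← mul_sum, chi_empty, φ.sum_mass]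
  · intro T hT hne
    rw [← mul_sum]
    have := h T (mem_low.2 ⟨nonempty_iff_ne_empty.2 hne,
      (card_le_card (mem_powerset.1 hT)).trans hS⟩)
    rw [Density.expect] at this
    rw [this, mul_zero]

theorem Density.IsKWiseUniform.expect_chi {φ : Density n} {k : ℕ} (h : φ.IsKWiseUniform k)
    {S : Finset (Fin n)} (hS : S.Nonempty) (hk : S.card ≤ k) : φ.expect (chi S) = 0 := by
  classical
  set N : ℝ := ∑ b : Cube n, if ∀ i ∈ S, b i = 1 then 1 else 0
  have hN : 0 < N := sum_pos' (fun b _ => by split_ifs <;> norm_num) ⟨1, mem_univ _, by simp⟩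
  -- `chi S` is constant on each cylinder over `S`, and `N` is the number of points in one, so it is
  -- a combination of cylinder indicators.
  have h1 : ∀ x, N * chi S x = ∑ a : Cube n, if ∀ i ∈ S, x i = a i then chi S a else 0 := by
    intro x
    rw [← Equiv.sum_comp (Equiv.mulLeft x), sum_mul]
    refine sum_congr rfl fun b _ => ?_
    by_cases hb : ∀ i ∈ S, b i = 1
    · have : chi S b = 1 := prod_eq_one fun i hi => by simp [hb i hi]
      rw [if_pos hb, if_pos fun i hi => by simp [hb i hi], Equiv.coe_mulLeft, chi_mul_arg, this]
      ring
    · rw [if_neg hb, if_neg, zero_mul]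
      intro hc
      exact hb fun i hi => by simpa using hc i hi
  have h2 : N * φ.expect (chi S) = 0 := by
    calc N * φ.expect (chi S) = ∑ x, φ.mass x * (N * chi S x) := by
          rw [Density.expect, mul_sum]
          exact sum_congr rfl fun x _ => by ring
      _ = ∑ a : Cube n, chi S a * φ.prob {x | ∀ i ∈ S, x i = a i} := by
          simp only [h1, Density.prob, mul_sum]
          rw [sum_comm]
          refine sum_congr rfl fun a _ => sum_congr rfl fun x _ => ?_
          by_cases hx : ∀ i ∈ S, x i = a i
          · simp only [Set.mem_ofPred_eq, if_pos hx, mul_comm]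
          · simp only [Set.mem_ofPred_eq, if_neg hx, mul_zero]
      _ = 0 := by
          simp only [h S hk, ← sum_mul, sum_chi hS, zero_mul]
  exact (mul_eq_zero.1 h2).resolve_left hN.ne'

/-- The sum of the squared Fourier coefficients of `φ` in degrees `1, …, k`. -/
noncomputable def Density.weight (φ : Density n) (k : ℕ) : ℝ :=
  ∑ S ∈ low n k, φ.expect (chi S) ^ 2

/-! ### Small low-degree weight implies closeness, by duality -/

/-- A vector of small norm is the vector of low-degree Fourier coefficients of a distribution. -/
theorem exists_density_expect_chi (k : ℕ) (τ : Finset (Fin n) → ℝ)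
    (hτ : 9 ^ k * ∑ S ∈ low n k, τ S ^ 2 ≤ 1) :
    ∃ η : Density n, ∀ S ∈ low n k, η.expect (chi S) = τ S := by
  classical
  let L : (Cube n → ℝ) →ₗ[ℝ] (low n k → ℝ) :=
    { toFun := fun w S => ∑ x, w x * chi S.1 x
      map_add' := fun u v => by
        ext S
        simp [add_mul, sum_add_distrib]
      map_smul' := fun r v => by
        ext S
        simp [mul_sum, mul_assoc] }
  have hL : ∀ w S, L w S = ∑ x, w x * chi S.1 x := fun _ _ => rfl
  by_cases hmem : (fun S : low n k => τ S.1) ∈ L '' stdSimplex ℝ (Cube n)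
  · obtain ⟨w, hw, hwL⟩ := hmem
    have h2 : ∀ x, 2 ^ n * w x / 2 ^ n = w x := fun x => by field_simp
    refine ⟨⟨fun x => 2 ^ n * w x, fun x => mul_nonneg (by positivity) (hw.1 x), ?_⟩, ?_⟩
    · rw [← mul_sum, hw.2]
      field_simp
    · intro S hS
      have := congrFun hwL ⟨S, hS⟩
      rw [hL] at this
      simp only [Density.expect, Density.mass, h2]
      exact this
  · exfalso
    have hconv : Convex ℝ (L '' stdSimplex ℝ (Cube n)) := (convex_stdSimplex ℝ _).linear_image L
    have hcl : IsClosed (L '' stdSimplex ℝ (Cube n)) :=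
      ((isCompact_stdSimplex ℝ (Cube n)).image L.continuous_of_finiteDimensional).isClosed
    obtain ⟨f, u, hf, hu⟩ := geometric_hahn_banach_closed_point hconv hcl hmem
    let c : Finset (Fin n) → ℝ := fun S => if h : S ∈ low n k then f (Pi.single ⟨S, h⟩ 1) else 0
    have hfc : ∀ v : Finset (Fin n) → ℝ, f (fun S : low n k => v S.1)
        = ∑ S ∈ low n k, c S * v S := by
      intro v
      rw [← sum_coe_sort]
      have := LinearMap.pi_apply_eq_sum_univ f.toLinearMap (fun S : low n k => v S.1)
      simp only [ContinuousLinearMap.coe_coe] at this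
      rw [this]
      refine sum_congr rfl fun S _ => ?_
      simp only [c, S.2, dif_pos, smul_eq_mul, mul_comm]
      congr 2
      ext T
      simp [Pi.single_apply, eq_comm]
    set M := ∑ S ∈ low n k, c S * τ S with hM
    have hlt : ∀ x, ∑ S ∈ low n k, c S * chi S x < M := by
      intro x
      rw [hM, ← hfc, ← hfc]
      refine lt_trans (hf _ ⟨Pi.single x 1, single_mem_stdSimplex ℝ x, ?_⟩) hu
      ext S
      rw [hL]
      simp [Pi.single_apply]
    -- At the vertices of the simplex the separation says that `M - ∑ c S * chi S` is positive on
    -- the whole cube.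
    let d : Finset (Fin n) → ℝ := fun S => if S = ∅ then M else -c S
    have hempty : ∅ ∉ low n k := by simp [mem_low]
    have hidx : ((univ : Finset (Fin n)).powerset.filter fun S => S.card ≤ k)
        = insert ∅ (low n k) := by
      ext S
      rcases S.eq_empty_or_nonempty with rfl | h
      · simp
      · simp [mem_low, h, h.ne_empty]
    have hne : ∀ S ∈ low n k, S ≠ ∅ := fun S hS => (mem_low.1 hS).1.ne_empty
    have hd : ∀ S ∈ low n k, d S = -c S := fun S hS => if_neg (hne S hS)
    have hd0 : d ∅ = M := if_pos rfl
    have hp : ∀ x, lowPoly univ k d x = M - ∑ S ∈ low n k, c S * chi S x := by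
      intro x
      rw [lowPoly, hidx, sum_insert hempty, sub_eq_add_neg, ← sum_neg_distrib, chi_empty, hd0,
        mul_one]
      congr 1
      exact sum_congr rfl fun S hS => by rw [hd S hS, neg_mul]
    have hpos : ∀ x, 0 < lowPoly univ k d x := fun x => by
      rw [hp]
      linarith [hlt x]
    have hmean : mean (lowPoly univ k d) = M := by
      have : lowPoly univ k d = fun x => ∑ S ∈ insert ∅ (low n k), d S * chi S x := by
        ext x
        rw [lowPoly, hidx]
      rw [this, mean_sum, sum_insert hempty]
      simp only [mean_const_mul, mean_chi]
      rw [sum_eq_zero fun S hS => ?_]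
      · simp [d]
      · rw [if_neg (hne S hS), mul_zero]
    have hsq : mean (fun x => lowPoly univ k d x ^ 2) = M ^ 2 + ∑ S ∈ low n k, c S ^ 2 := by
      simp only [lowPoly, hidx]
      rw [mean_sq_sum_chi, sum_insert hempty, hd0]
      congr 1
      exact sum_congr rfl fun S hS => by rw [hd S hS, neg_sq]
    have hMpos : 0 < M := hmean ▸ mean_pos hpos
    have hmain := mean_sq_le_of_lowPoly_pos univ k d hpos
    rw [hmean, hsq] at hmain
    have hcs : M ^ 2 ≤ (∑ S ∈ low n k, c S ^ 2) * ∑ S ∈ low n k, τ S ^ 2 :=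
      sum_mul_sq_le_sq_mul_sq _ _ _
    have hc0 : 0 ≤ ∑ S ∈ low n k, c S ^ 2 := sum_nonneg fun S _ => sq_nonneg _
    have h9 : (0 : ℝ) < 9 ^ k := by positivity
    have : 9 ^ k * M ^ 2 ≤ ∑ S ∈ low n k, c S ^ 2 := by
      calc 9 ^ k * M ^ 2 ≤ 9 ^ k * ((∑ S ∈ low n k, c S ^ 2) * ∑ S ∈ low n k, τ S ^ 2) := by gcongr
        _ = (∑ S ∈ low n k, c S ^ 2) * (9 ^ k * ∑ S ∈ low n k, τ S ^ 2) := by ring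
        _ ≤ _ := mul_le_of_le_one_right hc0 hτ
    -- `M ^ 2 + ∑ c S ^ 2 ≤ 9 ^ k * M ^ 2 ≤ ∑ c S ^ 2` contradicts `M > 0`.
    nlinarith [pow_pos hMpos 2]

/-- A distribution of small low-degree Fourier weight is close to a `k`-wise uniform one. -/
theorem Density.exists_isKWiseUniform_dTV_le (φ : Density n) (k : ℕ) {δ : ℝ} (hδ : 0 < δ)
    (h : 9 ^ k * φ.weight k ≤ δ ^ 2) :
    ∃ ψ : Density n, ψ.IsKWiseUniform k ∧ Density.dTV φ ψ ≤ δ := by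
  obtain ⟨η, hη⟩ := exists_density_expect_chi k (fun S => -φ.expect (chi S) / δ) (by
    have : ∀ S, (-φ.expect (chi S) / δ) ^ 2 = φ.expect (chi S) ^ 2 / δ ^ 2 := fun S => by
      rw [div_pow, neg_sq]
    simp only [this, ← sum_div]
    rw [← mul_div_assoc, div_le_one (by positivity)]
    exact h)
  have h1 : 0 < 1 + δ := by linarith
  -- The coefficients of `φ + δ η` cancel in degrees `1, …, k`, and normalizing by `1 + δ` costs
  -- distance at most `δ`.
  let ψ : Density n :=
    ⟨fun x => (φ.toFun x + δ * η.toFun x) / (1 + δ), fun x =>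
      div_nonneg (add_nonneg (φ.nonneg x) (mul_nonneg hδ.le (η.nonneg x))) h1.le, by
      rw [← sum_div, sum_add_distrib, ← mul_sum, div_right_comm, add_div, mul_div_assoc,
        φ.mean_eq_one, η.mean_eq_one, mul_one, div_self h1.ne']⟩
  refine ⟨ψ, ψ.isKWiseUniform_of_expect_chi k fun S hS => ?_, ?_⟩
  · have h2 : ψ.expect (chi S) = (φ.expect (chi S) + δ * η.expect (chi S)) / (1 + δ) := by
      simp only [Density.expect, mul_sum, ← sum_add_distrib, sum_div]
      refine sum_congr rfl fun x _ => ?_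
      simp only [Density.mass, ψ]
      field_simp
    rw [h2, hη S hS]
    field_simp
    simp
  · have h3 : ∀ x, |φ.toFun x - ψ.toFun x| ≤ δ * (φ.toFun x + η.toFun x) := by
      intro x
      have e : φ.toFun x - ψ.toFun x = δ * (φ.toFun x - η.toFun x) / (1 + δ) := by
        simp only [ψ]
        field_simp
        ring
      have ha : |φ.toFun x - η.toFun x| ≤ φ.toFun x + η.toFun x := by
        rw [abs_le]
        constructor <;> linarith [φ.nonneg x, η.nonneg x]
      rw [e, abs_div, abs_mul, abs_of_pos hδ, abs_of_pos h1]
      exact (div_le_self (by positivity) (by linarith)).trans (by gcongr)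
    unfold Density.dTV
    have h4 : (∑ x, |φ.toFun x - ψ.toFun x|) / 2 ^ n
        ≤ δ * ((∑ x, φ.toFun x) / 2 ^ n + (∑ x, η.toFun x) / 2 ^ n) := by
      rw [← add_div, ← sum_add_distrib, ← mul_div_assoc, mul_sum]
      gcongr
      exact h3 _
    rw [φ.mean_eq_one, η.mean_eq_one] at h4
    linarith

theorem Density.IsFarFromKWise.lt_weight {φ : Density n} {k : ℕ} {δ : ℝ} (hδ : 0 < δ)
    (h : φ.IsFarFromKWise k δ) : δ ^ 2 / 9 ^ k < φ.weight k := by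
  by_contra! hle
  rw [le_div_iff₀' (by positivity)] at hle
  obtain ⟨ψ, hψ, hd⟩ := φ.exists_isKWiseUniform_dTV_le k hδ hle
  exact absurd (h ψ hψ) hd.not_gt

/-! ### Moments of the two-sample statistic -/

/-- The products of pairs of features. -/
noncomputable def featSq {Ω ι : Type*} (ψ : ι → Ω → ℝ) (q : ι × ι) (x : Ω) : ℝ :=
  ψ q.1 x * ψ q.2 x

theorem sum_featSq {Ω ι : Type*} [Fintype ι] (ψ : ι → Ω → ℝ) (x y : Ω) :
    ∑ q, featSq ψ q x * featSq ψ q y = (∑ a, ψ a x * ψ a y) ^ 2 := by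
  rw [sq, sum_mul_sum, Fintype.sum_prod_type]
  exact sum_congr rfl fun a _ => sum_congr rfl fun b _ => by simp only [featSq]; ring

section SecondMoment

variable {Ω ι : Type*} [Fintype Ω] [Fintype ι]

/-- The expectation of `f` over `m` independent samples from the weights `p`. -/
noncomputable def sampleExpect (p : Ω → ℝ) (m : ℕ) (f : (Fin m → Ω) → ℝ) : ℝ :=
  ∑ X, (∏ i, p (X i)) * f X

/-- The covariance `E ψ_a ψ_b` of two features. -/
noncomputable def featCov (p : Ω → ℝ) (ψ : ι → Ω → ℝ) (a b : ι) : ℝ := ∑ x, p x * (ψ a x * ψ b x)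

/-- The expectation `E ψ_a` of a feature. -/
noncomputable def featMean (p : Ω → ℝ) (ψ : ι → Ω → ℝ) (a : ι) : ℝ := ∑ x, p x * ψ a x

theorem sampleExpect_sum (p : Ω → ℝ) (m : ℕ) {κ : Type*} (s : Finset κ)
    (f : κ → (Fin m → Ω) → ℝ) :
    sampleExpect p m (fun X => ∑ a ∈ s, f a X) = ∑ a ∈ s, sampleExpect p m (f a) := by
  simp only [sampleExpect, mul_sum]
  rw [sum_comm]

theorem sampleExpect_prod (p : Ω → ℝ) (m : ℕ) (g : Fin m → Ω → ℝ) :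
    sampleExpect p m (fun X => ∏ i, g i (X i)) = ∏ i, ∑ x, p x * g i x := by
  classical
  rw [Finset.prod_univ_sum, Fintype.piFinset_univ, sampleExpect]
  simp only [prod_mul_distrib]

variable {p : Ω → ℝ}

theorem sampleExpect_single (hp : ∑ x, p x = 1) (m : ℕ) (i : Fin m) (g : Ω → ℝ) :
    sampleExpect p m (fun X => g (X i)) = ∑ x, p x * g x := by
  have h := sampleExpect_prod p m fun l x => if l = i then g x else 1
  simp only [prod_ite_eq', mem_univ, if_true] at h
  rw [h, prod_eq_single i]
  · simp
  · intro j _ hj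
    simp [hj, hp]
  · simp

theorem sampleExpect_pair (hp : ∑ x, p x = 1) (m : ℕ) {i j : Fin m} (hij : i ≠ j) (g h : Ω → ℝ) :
    sampleExpect p m (fun X => g (X i) * h (X j)) = (∑ x, p x * g x) * ∑ x, p x * h x := by
  have e := sampleExpect_prod p m fun l x => (if l = i then g x else 1) * if l = j then h x else 1
  simp only [prod_mul_distrib, prod_ite_eq', mem_univ, if_true] at e
  rw [e, prod_eq_mul i j hij]
  · simp [hij, hij.symm]
  · intro l _ hl
    simp [hl.1, hl.2, hp]
  · simp
  · simp

theorem sampleExpect_sum_mul_sum (hp : ∑ x, p x = 1) (m : ℕ) (g h : Ω → ℝ) :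
    sampleExpect p m (fun X => (∑ i, g (X i)) * ∑ j, h (X j))
      = m * (∑ x, p x * (g x * h x)) + m * (m - 1) * ((∑ x, p x * g x) * ∑ x, p x * h x) := by
  classical
  have hexp : (fun X : Fin m → Ω => (∑ i, g (X i)) * ∑ j, h (X j))
      = fun X => ∑ i, ∑ j, g (X i) * h (X j) := funext fun X => sum_mul_sum _ _ _ _
  rw [hexp, sampleExpect_sum]
  have : ∀ i : Fin m, sampleExpect p m (fun X => ∑ j, g (X i) * h (X j))
      = (∑ x, p x * (g x * h x)) + (m - 1) * ((∑ x, p x * g x) * ∑ x, p x * h x) := by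
    intro i
    rw [sampleExpect_sum, ← add_sum_erase _ _ (mem_univ i),
      sampleExpect_single hp m i fun x => g x * h x,
      sum_congr rfl fun j hj => sampleExpect_pair hp m (ne_of_mem_erase hj).symm g h,
      sum_const, card_erase_of_mem (mem_univ i), card_univ, Fintype.card_fin, nsmul_eq_mul,
      Nat.cast_sub (Nat.one_le_iff_ne_zero.2 fun e => (e ▸ i).elim0), Nat.cast_one]
  simp only [this, sum_const, card_univ, Fintype.card_fin, nsmul_eq_mul]
  ring

theorem sampleExpect_sum_single (hp : ∑ x, p x = 1) (m : ℕ) (g : Ω → ℝ) :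
    sampleExpect p m (fun X => ∑ i, g (X i)) = m * ∑ x, p x * g x := by
  rw [sampleExpect_sum, sum_congr rfl fun i _ => sampleExpect_single hp m i g]
  simp

theorem sampleExpect_add (m : ℕ) (f g : (Fin m → Ω) → ℝ) :
    sampleExpect p (m + m) (fun X => f (fun i => X (Fin.castAdd m i)) *
      g (fun i => X (Fin.natAdd m i))) = sampleExpect p m f * sampleExpect p m g := by
  rw [sampleExpect, ← Equiv.sum_comp (Fin.appendEquiv m m), Fintype.sum_prod_type, sampleExpect,
    sampleExpect, sum_mul_sum]
  refine sum_congr rfl fun X _ => sum_congr rfl fun Y _ => ?_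
  simp only [Fin.appendEquiv, Equiv.coe_fn_mk, Fin.prod_univ_add, Fin.append_left,
    Fin.append_right]
  ring

/-- The inner product of the empirical feature sums of the two halves of a sample. -/
noncomputable def crossStat {m : ℕ} (ψ : ι → Ω → ℝ) (X : Fin (m + m) → Ω) : ℝ :=
  ∑ a, (∑ i, ψ a (X (Fin.castAdd m i))) * ∑ j, ψ a (X (Fin.natAdd m j))

theorem sampleExpect_crossStat (hp : ∑ x, p x = 1) (m : ℕ) (ψ : ι → Ω → ℝ) :
    sampleExpect p (m + m) (crossStat ψ) = m ^ 2 * ∑ a, featMean p ψ a ^ 2 := by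
  unfold crossStat
  rw [sampleExpect_sum, mul_sum]
  refine sum_congr rfl fun a _ => ?_
  rw [sampleExpect_add m (fun X => ∑ i, ψ a (X i)) fun X => ∑ i, ψ a (X i),
    sampleExpect_sum_single hp, featMean]
  ring

/-- The halves are independent with equal law, hence the square. Within a half, equal indices
contribute the covariance and distinct ones the product of means. -/
theorem sampleExpect_crossStat_sq (hp : ∑ x, p x = 1) (m : ℕ) (ψ : ι → Ω → ℝ) :
    sampleExpect p (m + m) (fun X => crossStat ψ X ^ 2)
      = ∑ a, ∑ b, (m * featCov p ψ a b
          + m * (m - 1) * (featMean p ψ a * featMean p ψ b)) ^ 2 := by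
  have h : ∀ X : Fin (m + m) → Ω, crossStat ψ X ^ 2 = ∑ a, ∑ b,
      ((∑ i, ψ a (X (Fin.castAdd m i))) * ∑ i, ψ b (X (Fin.castAdd m i))) *
        ((∑ j, ψ a (X (Fin.natAdd m j))) * ∑ j, ψ b (X (Fin.natAdd m j))) := by
    intro X
    rw [crossStat, sq, sum_mul_sum]
    exact sum_congr rfl fun a _ => sum_congr rfl fun b _ => by ring
  simp only [h]
  rw [sampleExpect_sum]
  refine sum_congr rfl fun a _ => ?_
  rw [sampleExpect_sum]
  refine sum_congr rfl fun b _ => ?_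
  rw [sampleExpect_add m (fun X => (∑ i, ψ a (X i)) * ∑ i, ψ b (X i))
      fun X => (∑ i, ψ a (X i)) * ∑ i, ψ b (X i), sampleExpect_sum_mul_sum hp]
  simp only [featCov, featMean]
  ring

theorem sampleExpect_one (hp : ∑ x, p x = 1) (m : ℕ) : sampleExpect p m (fun _ => 1) = 1 := by
  have := sampleExpect_prod p m fun _ _ => 1
  simpa [hp] using this

/-- The variance of `crossStat` in terms of the mean and covariance of the features. -/
theorem sampleExpect_crossStat_sub_sq_le (hp : ∑ x, p x = 1) (m : ℕ) (ψ : ι → Ω → ℝ) {w F : ℝ}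
    (hw : ∑ a, featMean p ψ a ^ 2 = w) (hF : 0 ≤ F)
    (hF2 : ∑ a, ∑ b, featCov p ψ a b ^ 2 ≤ F ^ 2) :
    sampleExpect p (m + m) (fun X => (crossStat ψ X - m ^ 2 * w) ^ 2)
      ≤ m ^ 2 * F ^ 2 + 2 * m ^ 3 * (w * F) := by
  have hw0 : 0 ≤ w := hw ▸ sum_nonneg fun a _ => sq_nonneg _
  have hexp : sampleExpect p (m + m) (fun X => (crossStat ψ X - m ^ 2 * w) ^ 2)
      = sampleExpect p (m + m) (fun X => crossStat ψ X ^ 2) - (m ^ 2 * w) ^ 2 := by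
    have h1 := sampleExpect_crossStat hp m ψ
    have h2 := sampleExpect_one hp (m + m)
    rw [hw] at h1
    have : sampleExpect p (m + m) (fun X => (crossStat ψ X - m ^ 2 * w) ^ 2)
        = sampleExpect p (m + m) (fun X => crossStat ψ X ^ 2)
          - 2 * (m ^ 2 * w) * sampleExpect p (m + m) (crossStat ψ)
          + (m ^ 2 * w) ^ 2 * sampleExpect p (m + m) (fun _ => 1) := by
      simp only [sampleExpect, mul_sum, ← sum_sub_distrib, ← sum_add_distrib]
      exact sum_congr rfl fun X _ => by ring
    rw [this, h1, h2]
    ring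
  set D := ∑ a, ∑ b, featMean p ψ a * featMean p ψ b * featCov p ψ a b
  have hmm : ∑ a, ∑ b, (featMean p ψ a * featMean p ψ b) ^ 2 = w ^ 2 := by
    rw [← hw, sq (∑ a, _), sum_mul_sum]
    exact sum_congr rfl fun a _ => sum_congr rfl fun b _ => by ring
  have hD : D ≤ w * F := by
    refine le_of_sq_le_sq ?_ (by positivity)
    have := sum_mul_sq_le_sq_mul_sq (univ : Finset (ι × ι))
      (fun q => featMean p ψ q.1 * featMean p ψ q.2) (fun q => featCov p ψ q.1 q.2)
    simp only [Fintype.sum_prod_type] at this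
    rw [hmm] at this
    rw [mul_pow]
    exact this.trans (by gcongr)
  have hexp2 : ∑ a, ∑ b, (m * featCov p ψ a b
      + m * (m - 1) * (featMean p ψ a * featMean p ψ b)) ^ 2
      = m ^ 2 * (∑ a, ∑ b, featCov p ψ a b ^ 2) + 2 * m ^ 2 * (m - 1) * D
        + m ^ 2 * (m - 1) ^ 2 * w ^ 2 := by
    rw [← hmm]
    simp only [D, mul_sum, ← sum_add_distrib]
    exact sum_congr rfl fun a _ => sum_congr rfl fun b _ => by ring
  rw [hexp, sampleExpect_crossStat_sq hp, hexp2]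
  rcases Nat.eq_zero_or_pos m with rfl | hm
  · simp
  · have hm1 : (1 : ℝ) ≤ m := by exact_mod_cast hm
    have e1 : 2 * (m : ℝ) ^ 2 * (m - 1) * D ≤ 2 * m ^ 3 * (w * F) := by
      calc _ ≤ 2 * (m : ℝ) ^ 2 * (m - 1) * (w * F) :=
            mul_le_mul_of_nonneg_left hD (mul_nonneg (by positivity) (by linarith))
        _ ≤ _ := by
          have : 0 ≤ (m : ℝ) ^ 2 * (w * F) := by positivity
          nlinarith
    have e2 : (m : ℝ) ^ 2 * (m - 1) ^ 2 * w ^ 2 ≤ (m ^ 2 * w) ^ 2 := by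
      calc _ ≤ (m : ℝ) ^ 2 * m ^ 2 * w ^ 2 := by
            gcongr
            linarith
        _ = _ := by ring
    have e3 := mul_le_mul_of_nonneg_left hF2 (sq_nonneg (m : ℝ))
    linarith

theorem sum_featMean_sq (ψ : ι → Ω → ℝ) :
    ∑ a, featMean p ψ a ^ 2 = ∑ x, ∑ y, p x * p y * ∑ a, ψ a x * ψ a y := by
  have h : ∀ a, featMean p ψ a ^ 2 = ∑ x, ∑ y, p x * p y * (ψ a x * ψ a y) := fun a => by
    rw [featMean, sq, sum_mul_sum]
    exact sum_congr rfl fun x _ => sum_congr rfl fun y _ => by ring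
  simp only [h, mul_sum]
  rw [sum_comm]
  exact sum_congr rfl fun x _ => sum_comm

/-- This identity lets `crossStat` on product features estimate the quantity controlling the
variance of `crossStat` on the features themselves. -/
theorem sum_featCov_sq (ψ : ι → Ω → ℝ) :
    ∑ a, ∑ b, featCov p ψ a b ^ 2 = ∑ q, featMean p (featSq ψ) q ^ 2 := by
  rw [Fintype.sum_prod_type]
  rfl

/-- With the kernel `K(x, y) = ∑ ψ_a(x) ψ_a(y)`, this compares `E K ^ 4` with `E K ^ 2` over
independent `x, y`, using `|K| ≤ card ι`. -/
theorem sum_featCov_featSq_le (hp0 : ∀ x, 0 ≤ p x) (ψ : ι → Ω → ℝ) (hψ : ∀ a x, |ψ a x| ≤ 1) :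
    ∑ q, ∑ r, featCov p (featSq ψ) q r ^ 2
      ≤ Fintype.card ι ^ 2 * ∑ a, ∑ b, featCov p ψ a b ^ 2 := by
  rw [sum_featCov_sq, sum_featCov_sq, sum_featMean_sq, sum_featMean_sq]
  simp only [sum_featSq, mul_sum]
  refine sum_le_sum fun x _ => sum_le_sum fun y _ => ?_
  have hK : (∑ a, ψ a x * ψ a y) ^ 2 ≤ (Fintype.card ι : ℝ) ^ 2 := by
    rw [sq_le_sq, Nat.abs_cast]
    calc _ ≤ ∑ a, |ψ a x * ψ a y| := abs_sum_le_sum_abs _ _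
      _ ≤ ∑ _a : ι, (1 : ℝ) := sum_le_sum fun a _ => by
        rw [abs_mul]
        exact mul_le_one₀ (hψ a x) (abs_nonneg _) (hψ a y)
      _ = _ := by simp
  calc p x * p y * ((∑ a, ψ a x * ψ a y) ^ 2) ^ 2
      = (p x * p y * (∑ a, ψ a x * ψ a y) ^ 2) * (∑ a, ψ a x * ψ a y) ^ 2 := by ring
    _ ≤ (p x * p y * (∑ a, ψ a x * ψ a y) ^ 2) * (Fintype.card ι : ℝ) ^ 2 := by
      have := hp0 x
      have := hp0 y
      gcongr
    _ = _ := by ring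

end SecondMoment

/-! ### Tail bounds for samples -/

theorem Density.sampleProb_le_div (φ : Density n) (m : ℕ) (A : Set (Fin m → Cube n))
    (f : (Fin m → Cube n) → ℝ) {t : ℝ} (ht : 0 < t) (hf : ∀ X, 0 ≤ f X) (hA : ∀ X ∈ A, t ≤ f X) :
    φ.sampleProb m A ≤ sampleExpect φ.mass m f / t := by
  rw [le_div_iff₀ ht, Density.sampleProb, sampleExpect, sum_mul]
  refine sum_le_sum fun X _ => ?_
  have h0 : 0 ≤ ∏ i, φ.mass (X i) := prod_nonneg fun i _ => φ.mass_nonneg _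
  split_ifs with h
  · exact mul_le_mul_of_nonneg_left (hA X h) h0
  · rw [zero_mul]
    exact mul_nonneg h0 (hf X)

theorem Density.sampleProb_compl (φ : Density n) (m : ℕ) (A : Set (Fin m → Cube n)) :
    φ.sampleProb m A = 1 - φ.sampleProb m Aᶜ := by
  have h := sampleExpect_one φ.sum_mass m
  rw [← h, Density.sampleProb, Density.sampleProb, sampleExpect, ← sum_sub_distrib]
  refine sum_congr rfl fun X _ => ?_
  by_cases hX : X ∈ A <;> simp [hX]

theorem Density.sampleProb_union_le (φ : Density n) (m : ℕ) {A B D : Set (Fin m → Cube n)}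
    (h : D ⊆ A ∪ B) : φ.sampleProb m D ≤ φ.sampleProb m A + φ.sampleProb m B := by
  simp only [Density.sampleProb]
  rw [← sum_add_distrib]
  refine sum_le_sum fun X _ => ?_
  have h0 : 0 ≤ ∏ i, φ.mass (X i) := prod_nonneg fun i _ => φ.mass_nonneg _
  by_cases hD : X ∈ D
  · rcases h hD with hA | hB
    · by_cases hB : X ∈ B <;> simp [hD, hA, hB, h0]
    · by_cases hA : X ∈ A <;> simp [hD, hA, hB, h0]
  · rw [if_neg hD]
    split_ifs <;> positivity

/-- Chebyshev's inequality for `crossStat`. -/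
theorem Density.sampleProb_crossStat_le {ι : Type*} [Fintype ι] (φ : Density n) (m : ℕ)
    (ψ : ι → Cube n → ℝ) {w F t : ℝ} (hw : ∑ a, featMean φ.mass ψ a ^ 2 = w) (hF : 0 ≤ F)
    (hF2 : ∑ a, ∑ b, featCov φ.mass ψ a b ^ 2 ≤ F ^ 2) (ht : 0 < t)
    (A : Set (Fin (m + m) → Cube n)) (hA : ∀ X ∈ A, t ≤ |crossStat ψ X - m ^ 2 * w|) :
    φ.sampleProb (m + m) A ≤ (m ^ 2 * F ^ 2 + 2 * m ^ 3 * (w * F)) / t ^ 2 := by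
  refine (φ.sampleProb_le_div (m + m) A (fun X => (crossStat ψ X - m ^ 2 * w) ^ 2)
    (pow_pos ht 2) (fun X => sq_nonneg _) fun X hX => ?_).trans ?_
  · rw [← sq_abs (crossStat ψ X - m ^ 2 * w)]
    exact pow_le_pow_left₀ ht.le (hA X hX) 2
  · gcongr
    exact sampleExpect_crossStat_sub_sq_le φ.sum_mass m ψ hw hF hF2

/-! ### Parities as features -/

/-- A nonempty set of at most `k` coordinates is the image of a map from `Fin k`; nonemptiness
allows repeating a value to fill it. -/
theorem card_low_le (n k : ℕ) : (low n k).card ≤ n ^ k := by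
  classical
  have h : low n k ⊆ univ.image fun f : Fin k → Fin n => univ.image f := by
    intro S hS
    obtain ⟨⟨a, ha⟩, hk⟩ := mem_low.1 hS
    have : Nonempty S := ⟨⟨a, ha⟩⟩
    obtain ⟨e⟩ : Nonempty (S ↪ Fin k) :=
      Function.Embedding.nonempty_of_card_le (by simpa using hk)
    refine mem_image.2 ⟨fun i => (Function.invFun e i).1, mem_univ _, ?_⟩
    ext b
    simp only [mem_image, mem_univ, true_and]
    constructor
    · rintro ⟨i, rfl⟩
      exact (Function.invFun e i).2
    · intro hb
      exact ⟨e ⟨b, hb⟩, by rw [Function.leftInverse_invFun e.injective]⟩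
  calc (low n k).card ≤ _ := card_le_card h
    _ ≤ _ := card_image_le
    _ = n ^ k := by simp

theorem card_low_pos {k : ℕ} (hn : 1 ≤ n) (hk : 1 ≤ k) : 0 < (low n k).card :=
  card_pos.2 ⟨{⟨0, hn⟩}, mem_low.2 ⟨singleton_nonempty _, by simpa using hk⟩⟩

/-- The features of the tester: the parities of degree `1, …, k`. -/
noncomputable def lowFeat (n k : ℕ) (S : low n k) (x : Cube n) : ℝ := chi S.1 x

theorem sum_featMean_lowFeat (φ : Density n) (k : ℕ) :
    ∑ S, featMean φ.mass (lowFeat n k) S ^ 2 = φ.weight k := by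
  exact sum_coe_sort (low n k) fun S => φ.expect (chi S) ^ 2

theorem featCov_lowFeat_self (φ : Density n) (k : ℕ) (S : low n k) :
    featCov φ.mass (lowFeat n k) S S = 1 := by
  simp only [featCov, lowFeat, chi_mul_self, mul_one, φ.sum_mass]

theorem card_le_sum_featCov_sq (φ : Density n) (k : ℕ) :
    ((low n k).card : ℝ) ≤ ∑ S, ∑ T, featCov φ.mass (lowFeat n k) S T ^ 2 := by
  calc ((low n k).card : ℝ) = ∑ S : low n k, featCov φ.mass (lowFeat n k) S S ^ 2 := by
        simp [featCov_lowFeat_self]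
    _ ≤ _ := sum_le_sum fun S _ =>
      single_le_sum (f := fun T => featCov φ.mass (lowFeat n k) S T ^ 2)
        (fun T _ => sq_nonneg _) (mem_univ S)

/-- The covariance of two parities is the coefficient at their symmetric difference, of size at most
`2 * k`, so the matrix is the identity. -/
theorem Density.IsKWiseUniform.sum_featCov_sq {φ : Density n} {k : ℕ}
    (h : φ.IsKWiseUniform (2 * k)) :
    ∑ S, ∑ T, featCov φ.mass (lowFeat n k) S T ^ 2 = (low n k).card := by
  have h0 : ∀ S T : low n k, featCov φ.mass (lowFeat n k) S T ^ 2 = if S = T then 1 else 0 := by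
    intro S T
    split_ifs with e
    · rw [e, featCov_lowFeat_self, one_pow]
    · have hne : (symmDiff S.1 T.1).Nonempty :=
        nonempty_iff_ne_empty.2 fun h' => e (Subtype.ext (symmDiff_eq_bot.1 h'))
      have hc : (symmDiff S.1 T.1).card ≤ 2 * k := by
        have h1 : (symmDiff S.1 T.1).card ≤ (S.1 ∪ T.1).card :=
          card_le_card symmDiff_le_sup
        have h2 := card_union_le S.1 T.1
        have h3 := (mem_low.1 S.2).2
        have h4 := (mem_low.1 T.2).2
        omega
      simp only [featCov, lowFeat, chi_mul_chi]
      have := h.expect_chi hne hc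
      rw [Density.expect] at this
      rw [this, sq, mul_zero]
  simp [h0]

theorem Density.IsKWiseUniform.weight_eq_zero {φ : Density n} {k : ℕ}
    (h : φ.IsKWiseUniform k) : φ.weight k = 0 :=
  sum_eq_zero fun S hS => by
    rw [h.expect_chi (mem_low.1 hS).1 (mem_low.1 hS).2, sq, mul_zero]

theorem Density.IsKWiseUniform.mono {φ : Density n} {k l : ℕ} (h : φ.IsKWiseUniform l)
    (hkl : k ≤ l) : φ.IsKWiseUniform k := fun S hS => h S (hS.trans hkl)

theorem Density.IsUniform.isKWiseUniform {φ : Density n} (h : φ.IsUniform) (k : ℕ) :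
    φ.IsKWiseUniform k := by
  refine φ.isKWiseUniform_of_expect_chi k fun S hS => ?_
  have h' : ∀ x, φ.toFun x = 1 := h
  simp only [Density.expect, Density.mass, h', ← mul_sum, sum_chi (mem_low.1 hS).1, mul_zero]

/-! ### The tester and its sample complexity -/

/-- Chebyshev for a deviation of half the mean; the value `1 / 6` lets two tests fail with total
probability at most `1 / 3`. -/
theorem chebyshev_bound_le {m w F : ℝ} (hm : 0 < m) (hw : 0 < w) (hF : 0 ≤ F)
    (h : 50 * F ≤ m * w) :
    (m ^ 2 * F ^ 2 + 2 * m ^ 3 * (w * F)) / (m ^ 2 * w / 2) ^ 2 ≤ 1 / 6 := by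
  rw [div_le_iff₀ (by positivity)]
  have hmw : 0 < m * w := by positivity
  have h1 : 2500 * F ^ 2 ≤ (m * w) ^ 2 := by nlinarith
  have h2 : 50 * (m * w * F) ≤ (m * w) ^ 2 := by nlinarith
  have h3 : F ^ 2 + 2 * (m * w * F) ≤ (m * w) ^ 2 / 24 := by nlinarith
  calc m ^ 2 * F ^ 2 + 2 * m ^ 3 * (w * F) = m ^ 2 * (F ^ 2 + 2 * (m * w * F)) := by ring
    _ ≤ m ^ 2 * ((m * w) ^ 2 / 24) := by gcongr
    _ = _ := by ring

/-- With enough samples, the `2k`-wise uniform distributions can be distinguished from those that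
are far from `k`-wise uniform. -/
theorem exists_tester {k : ℕ} (hn : 1 ≤ n) (hk : 1 ≤ k) {δ : ℝ} (hδ : 0 < δ) (hδ1 : δ ≤ 1)
    {m : ℕ} (hm : 100 * √((low n k).card : ℝ) ≤ m * (δ ^ 2 / 9 ^ k)) :
    ∃ T : Tester n (m + m), T.Distinguishes (fun φ => φ.IsKWiseUniform (2 * k))
      (fun φ => φ.IsFarFromKWise k δ) := by
  classical
  set θ := δ ^ 2 / 9 ^ k with hθ
  have hθ0 : 0 < θ := by positivity
  have hθ1 : θ ≤ 1 := by
    rw [hθ, div_le_one (by positivity)]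
    exact (pow_le_one₀ hδ.le hδ1).trans (one_le_pow₀ (by norm_num))
  have hL : ((low n k).card : ℝ) = √((low n k).card : ℝ) ^ 2 :=
    (Real.sq_sqrt (Nat.cast_nonneg _)).symm
  have hs : 0 < √((low n k).card : ℝ) := Real.sqrt_pos.2 (by exact_mod_cast card_low_pos hn hk)
  generalize √((low n k).card : ℝ) = s at hm hL hs
  have hm0 : (0 : ℝ) < m := by
    by_contra! hneg
    nlinarith
  have hm1 : 100 * s ≤ m := hm.trans (mul_le_of_le_one_right hm0.le hθ1)
  set ψ := lowFeat n k
  have hcov2 : ∀ φ : Density n, ∀ b : ℝ, ∑ S, ∑ T, featCov φ.mass ψ S T ^ 2 = b ^ 2 →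
      ∑ q, ∑ r, featCov φ.mass (featSq ψ) q r ^ 2 ≤ (s ^ 2 * b) ^ 2 := by
    intro φ b hb
    have := sum_featCov_featSq_le φ.mass_nonneg ψ fun S x => (abs_chi S.1 x).le
    rw [hb, Fintype.card_coe, hL] at this
    exact this.trans (by rw [mul_pow])
  let T : Tester n (m + m) := fun X =>
    -- The first threshold is half the least mean of a far distribution. The second lies between the
    -- mean `m ^ 2 * s ^ 2` of the Yes case and half the mean when `B > 4 * s ^ 2`.
    decide (crossStat ψ X ≤ m ^ 2 * θ / 2 ∧ crossStat (featSq ψ) X ≤ 2 * m ^ 2 * s ^ 2)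
  refine ⟨T, fun φ hφ => ?_, fun φ hφ => ?_⟩
  · have hw : ∑ S, featMean φ.mass ψ S ^ 2 = 0 := by
      rw [sum_featMean_lowFeat]
      exact (hφ.mono (by omega)).weight_eq_zero
    have hB : ∑ S, ∑ T, featCov φ.mass ψ S T ^ 2 = s ^ 2 := by
      rw [hφ.sum_featCov_sq, hL]
    have h1 : φ.sampleProb (m + m) {X | m ^ 2 * θ / 2 < crossStat ψ X} ≤ 1 / 6 := by
      refine (φ.sampleProb_crossStat_le m ψ hw hs.le hB.le
        (show 0 < m ^ 2 * θ / 2 by positivity) _ fun X hX => ?_).trans ?_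
      · have hX' : m ^ 2 * θ / 2 < crossStat ψ X := hX
        rw [mul_zero, sub_zero]
        exact hX'.le.trans (le_abs_self _)
      · rw [div_le_iff₀ (by positivity)]
        have h2 : (100 * s) ^ 2 ≤ (m * θ) ^ 2 := by gcongr
        have h3 : s ^ 2 ≤ (m * θ) ^ 2 / 24 := by nlinarith
        calc (m : ℝ) ^ 2 * s ^ 2 + 2 * m ^ 3 * (0 * s) = m ^ 2 * s ^ 2 := by ring
          _ ≤ m ^ 2 * ((m * θ) ^ 2 / 24) := by gcongr
          _ = _ := by ring
    have h2 : φ.sampleProb (m + m) {X | 2 * m ^ 2 * s ^ 2 < crossStat (featSq ψ) X} ≤ 1 / 6 := by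
      refine (φ.sampleProb_crossStat_le m (featSq ψ) ((sum_featCov_sq ψ).symm.trans hB)
        (show 0 ≤ s ^ 2 * s by positivity) (hcov2 φ s hB)
        (show 0 < m ^ 2 * s ^ 2 / 2 by positivity) _ fun X hX => ?_).trans
        (chebyshev_bound_le hm0 (by positivity) (by positivity) (by nlinarith [sq_nonneg s]))
      have hX' : 2 * m ^ 2 * s ^ 2 < crossStat (featSq ψ) X := hX
      have : (0 : ℝ) < m ^ 2 * s ^ 2 := by positivity
      exact le_trans (by linarith) (le_abs_self _)
    rw [φ.sampleProb_compl]
    have h3 := φ.sampleProb_union_le (m + m) (A := {X | m ^ 2 * θ / 2 < crossStat ψ X})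
      (B := {X | 2 * m ^ 2 * s ^ 2 < crossStat (featSq ψ) X}) (D := {X | T X = true}ᶜ) (by
        intro X hX
        have hX' : ¬ (T X = true) := hX
        rw [decide_eq_true_iff, not_and_or, not_le, not_le] at hX'
        exact hX')
    linarith
  · rw [φ.sampleProb_compl]
    have hsub : ∀ X ∈ {X | T X = false}ᶜ,
        crossStat ψ X ≤ m ^ 2 * θ / 2 ∧ crossStat (featSq ψ) X ≤ 2 * m ^ 2 * s ^ 2 := by
      intro X hX
      have hX' : ¬ (T X = false) := hX
      rw [Bool.not_eq_false] at hX'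
      exact of_decide_eq_true hX'
    suffices φ.sampleProb (m + m) {X | T X = false}ᶜ ≤ 1 / 6 by linarith
    obtain ⟨B, hBdef⟩ : ∃ B, ∑ S, ∑ T, featCov φ.mass ψ S T ^ 2 = B := ⟨_, rfl⟩
    have hLB : s ^ 2 ≤ B := hL ▸ hBdef ▸ card_le_sum_featCov_sq φ k
    by_cases hB : B ≤ 4 * s ^ 2
    · have hW : θ < φ.weight k := hφ.lt_weight hδ
      have hW0 : 0 < φ.weight k := hθ0.trans hW
      refine (φ.sampleProb_crossStat_le m ψ (sum_featMean_lowFeat φ k)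
        (show 0 ≤ 2 * s by positivity) (hBdef.le.trans (hB.trans (by rw [mul_pow]; norm_num)))
        (show 0 < m ^ 2 * φ.weight k / 2 by positivity) _ fun X hX => ?_).trans
        (chebyshev_bound_le hm0 hW0 (by positivity) (by nlinarith))
      have h1 := (hsub X hX).1
      have h2 : (m : ℝ) ^ 2 * θ ≤ m ^ 2 * φ.weight k := by gcongr
      exact le_trans (by linarith) (neg_le_abs _)
    · have hB0 : 0 < B := lt_of_lt_of_le (by positivity) hLB
      have hbB : √B ^ 2 = B := Real.sq_sqrt hB0.le
      have hsb : s ≤ √B := Real.le_sqrt_of_sq_le hLB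
      refine (φ.sampleProb_crossStat_le m (featSq ψ) ((sum_featCov_sq ψ).symm.trans hBdef)
        (show 0 ≤ s ^ 2 * √B by positivity) (hcov2 φ √B (hBdef.trans hbB.symm))
        (show 0 < m ^ 2 * B / 2 by positivity) _ fun X hX => ?_).trans
        (chebyshev_bound_le hm0 hB0 (by positivity) ?_)
      · have h1 := (hsub X hX).2
        have h2 : (m : ℝ) ^ 2 * (4 * s ^ 2) ≤ m ^ 2 * B := by gcongr; exact (not_le.1 hB).le
        exact le_trans (by linarith) (neg_le_abs _)
      · have h3 : s * (50 * s) ≤ √B * m := by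
          apply mul_le_mul hsb (by linarith) (by positivity) (Real.sqrt_nonneg _)
        calc 50 * (s ^ 2 * √B) = (s * (50 * s)) * √B := by ring
          _ ≤ (√B * m) * √B := by gcongr
          _ = m * √B ^ 2 := by ring
          _ = m * B := by rw [hbB]

/-- The sample complexity of distinguishing `2k`-wise uniform from far from `k`-wise uniform. -/
theorem exists_tester_card_le {k : ℕ} (hn : 1 ≤ n) (hk : 1 ≤ k) {δ : ℝ} (hδ : 0 < δ)
    (hδ1 : δ ≤ 1) :
    ∃ m : ℕ, (m : ℝ) ≤ 1818 ^ k * (n : ℝ) ^ ((k : ℝ) / 2) * (1 / δ ^ 2) ∧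
      ∃ T : Tester n m, T.Distinguishes (fun φ => φ.IsKWiseUniform (2 * k))
        (fun φ => φ.IsFarFromKWise k δ) := by
  set s := √((low n k).card : ℝ)
  have hs1 : 1 ≤ s := Real.one_le_sqrt.2 (by exact_mod_cast card_low_pos hn hk)
  have hsn : s ≤ (n : ℝ) ^ ((k : ℝ) / 2) := by
    calc s ≤ √((n : ℝ) ^ k) := Real.sqrt_le_sqrt (by exact_mod_cast card_low_le n k)
      _ = (n : ℝ) ^ ((k : ℝ) / 2) := by
        rw [Real.sqrt_eq_rpow, ← Real.rpow_natCast, ← Real.rpow_mul (Nat.cast_nonneg n)]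
        congr 1
        ring
  set θ := δ ^ 2 / 9 ^ k with hθ
  have hθ0 : 0 < θ := by positivity
  have hθ1 : θ ≤ 1 := by
    rw [hθ, div_le_one (by positivity)]
    exact (pow_le_one₀ hδ.le hδ1).trans (one_le_pow₀ (by norm_num))
  refine ⟨⌈100 * s / θ⌉₊ + ⌈100 * s / θ⌉₊, ?_, exists_tester hn hk hδ hδ1 ?_⟩
  · have h1 : (⌈100 * s / θ⌉₊ : ℝ) ≤ 100 * s / θ + 1 := (Nat.ceil_lt_add_one (by positivity)).le
    have h2 : 1 ≤ s / θ := by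
      rw [one_le_div hθ0]
      linarith
    -- `202 = 2 * (100 + 1)`: two halves, with rounding up absorbed by `s / θ ≥ 1`.
    have h3 : (202 : ℝ) * 9 ^ k ≤ 1818 ^ k := by
      calc (202 : ℝ) * 9 ^ k ≤ 202 ^ k * 9 ^ k := by
            gcongr
            exact le_self_pow₀ (by norm_num) (by omega)
        _ = 1818 ^ k := by rw [← mul_pow]; norm_num
    push_cast
    calc (⌈100 * s / θ⌉₊ : ℝ) + ⌈100 * s / θ⌉₊ ≤ 2 * (100 * (s / θ) + s / θ) := by
          rw [mul_div_assoc] at h1 ⊢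
          linarith
      _ = 202 * 9 ^ k * s * (1 / δ ^ 2) := by
          rw [hθ]
          field_simp
          norm_num
      _ ≤ _ := by gcongr
  · have := Nat.le_ceil (100 * s / θ)
    rwa [div_le_iff₀ hθ0] at this

/-! ### Deducing both bounds -/

theorem Tester.Distinguishes.mono {m : ℕ} {T : Tester n m} {Y Y' N : Density n → Prop}
    (h : T.Distinguishes Y N) (hY : ∀ φ, Y' φ → Y φ) : T.Distinguishes Y' N :=
  ⟨fun φ hφ => h.1 φ (hY φ hφ), h.2⟩

/-- No distribution on one bit is more than `1/2`-far from uniform. -/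
theorem Density.not_isFarFromKWise_one (φ : Density 1) (k : ℕ) {δ : ℝ} (hδ : 1 / 2 ≤ δ) :
    ¬ φ.IsFarFromKWise k δ := by
  intro h
  let u : Density 1 := ⟨fun _ => 1, fun _ => zero_le_one, by simp⟩
  have hu : u.IsUniform := fun _ => rfl
  have h1 := h u (hu.isKWiseUniform k)
  have hsum : ∑ x, φ.toFun x = 2 := by
    have := φ.mean_eq_one
    linarith
  have h2 : ∀ x, |φ.toFun x - u.toFun x| ≤ 1 := fun x => by
    have h3 : φ.toFun x ≤ ∑ y, φ.toFun y := single_le_sum (fun y _ => φ.nonneg y) (mem_univ x)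
    have h4 := φ.nonneg x
    change |φ.toFun x - 1| ≤ 1
    rw [abs_le]
    constructor <;> linarith
  have h5 : ∑ x, |φ.toFun x - u.toFun x| ≤ 2 := by
    calc _ ≤ ∑ _x : Cube 1, (1 : ℝ) := sum_le_sum fun x _ => h2 x
      _ = 2 := by simp
  unfold Density.dTV at h1
  linarith

end KWise

theorem theorem5 :
    (∃ C : ℝ, 0 < C ∧ ∀ n k : ℕ, 1 ≤ n → 1 ≤ k → ∀ δ : ℝ, 0 < δ → δ ≤ 1 →
      ∃ m : ℕ,
        (m : ℝ) ≤ (C * k) ^ k * (n : ℝ) ^ ((k : ℝ) / 2) * (1 / δ ^ 2)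
          * (Real.log (n / δ)) ^ ((k : ℝ) / 2) ∧
        ∃ T : KWise.Tester n m,
          T.Distinguishes (fun φ => φ.IsUniform) (fun φ => φ.IsFarFromKWise k δ)) ∧
    (∃ C : ℝ, 0 < C ∧ ∀ n k : ℕ, 1 ≤ n → 1 ≤ k → ∀ δ : ℝ, 0 < δ → δ ≤ 1 →
      ∀ α : ℝ, 4 < α →
      ∃ m : ℕ,
        (m : ℝ) ≤ (C * α) ^ ((k : ℝ) / 2) * (n : ℝ) ^ ((k : ℝ) / 2) * (1 / δ ^ 2)
          * ((n : ℝ) ^ k / δ ^ 4) ^ (1 / (α - 2)) ∧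
        ∃ T : KWise.Tester n m,
          T.Distinguishes (fun φ => φ.IsKWiseUniform ⌊α * k⌋₊)
            (fun φ => φ.IsFarFromKWise k δ)) := by
  have hpow : ∀ (a : ℝ) (k : ℕ), 0 ≤ a → (a ^ 2) ^ ((k : ℝ) / 2) = a ^ k := by
    intro a k ha
    rw [← Real.rpow_natCast, ← Real.rpow_mul ha, ← Real.rpow_natCast]
    congr 1
    push_cast
    ring
  constructor
  · refine ⟨3636, by norm_num, fun n k hn hk δ hδ hδ1 => ?_⟩
    have hn' : (1 : ℝ) ≤ n := by exact_mod_cast hn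
    have hk' : (1 : ℝ) ≤ k := by exact_mod_cast hk
    -- Here the logarithm can be arbitrarily small, even zero, but no distribution is far, so no
    -- samples are needed. Otherwise `log (n / δ) ≥ 1 / 4`, paid for by doubling `1818`.
    by_cases hcase : n = 1 ∧ 1 / 2 ≤ δ
    · obtain ⟨rfl, hδ2⟩ := hcase
      refine ⟨0, ?_, fun _ => true, fun φ _ => ?_, fun φ hφ => ?_⟩
      · have : 0 ≤ Real.log ((1 : ℕ) / δ) := Real.log_nonneg (by
          rw [Nat.cast_one, one_le_div hδ]
          exact hδ1)
        rw [Nat.cast_zero]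
        positivity
      · simp [KWise.Density.sampleProb]
        norm_num
      · exact absurd hφ (φ.not_isFarFromKWise_one k hδ2)
    · obtain ⟨m, hm, T, hT⟩ := KWise.exists_tester_card_le hn hk hδ hδ1
      refine ⟨m, hm.trans ?_, T, hT.mono fun φ hφ => hφ.isKWiseUniform _⟩
      have h2 : 2 ≤ (n : ℝ) / δ := by
        rw [le_div_iff₀ hδ]
        by_cases h1 : n = 1
        · have : δ < 1 / 2 := not_le.1 fun h => hcase ⟨h1, h⟩
          linarith
        · have : (2 : ℝ) ≤ n := by exact_mod_cast (by omega : 2 ≤ n)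
          linarith
      have hlog : (1 / 2 : ℝ) ^ 2 ≤ Real.log (n / δ) := by
        have h3 := Real.log_le_log (by norm_num) h2
        have h4 := Real.log_two_gt_d9
        linarith
      have hlogk : (1 / 2 : ℝ) ^ k ≤ Real.log (n / δ) ^ ((k : ℝ) / 2) := by
        rw [← hpow _ _ (by norm_num)]
        exact Real.rpow_le_rpow (by positivity) hlog (by positivity)
      have hC : (1818 : ℝ) ^ k ≤ (3636 * k) ^ k * (1 / 2) ^ k := by
        rw [← mul_pow]
        gcongr
        linarith
      calc (1818 : ℝ) ^ k * (n : ℝ) ^ ((k : ℝ) / 2) * (1 / δ ^ 2)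
          ≤ ((3636 * k) ^ k * (1 / 2) ^ k) * (n : ℝ) ^ ((k : ℝ) / 2) * (1 / δ ^ 2) := by gcongr
        _ = (3636 * k) ^ k * (n : ℝ) ^ ((k : ℝ) / 2) * (1 / δ ^ 2) * (1 / 2) ^ k := by ring
        _ ≤ _ := by gcongr
  · refine ⟨1818 ^ 2, by norm_num, fun n k hn hk δ hδ hδ1 α hα => ?_⟩
    have hn' : (1 : ℝ) ≤ n := by exact_mod_cast hn
    obtain ⟨m, hm, T, hT⟩ := KWise.exists_tester_card_le hn hk hδ hδ1
    -- Only `2 * k ≤ α * k` is needed from the uniformity; the last factor of the bound is at least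
    -- `1`.
    refine ⟨m, hm.trans ?_, T, hT.mono fun φ hφ => hφ.mono (Nat.le_floor ?_)⟩
    · have h1 : (1 : ℝ) ≤ ((n : ℝ) ^ k / δ ^ 4) ^ (1 / (α - 2)) := by
        refine Real.one_le_rpow ?_ (one_div_nonneg.2 (by linarith))
        rw [one_le_div (by positivity)]
        exact (pow_le_one₀ hδ.le hδ1).trans (one_le_pow₀ hn')
      have h2 : (1818 : ℝ) ^ k ≤ (1818 ^ 2 * α) ^ ((k : ℝ) / 2) := by
        rw [← hpow _ _ (by norm_num)]
        exact Real.rpow_le_rpow (by positivity) (by nlinarith) (by positivity)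
      calc (1818 : ℝ) ^ k * (n : ℝ) ^ ((k : ℝ) / 2) * (1 / δ ^ 2)
          ≤ (1818 ^ 2 * α) ^ ((k : ℝ) / 2) * (n : ℝ) ^ ((k : ℝ) / 2) * (1 / δ ^ 2) := by gcongr
        _ ≤ _ := le_mul_of_one_le_right (by positivity) h1
    · push_cast
      gcongr
      linarith
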